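/- **Online non-metric multi-facility location.** There are $m$ facilities and a positive integer $k\le m$. Facility $j$ has an opening cost $f_j\in[0,\infty)$, and each client has a connecting cost in $[0,\infty)$ to each facility; the costs are otherwise arbitrary (no metric is assumed). A sequence of at most $n$ clients arrives one by one. The algorithm knows $m$, $n$, $k$ and the opening costs in advance; the connecting costs of a client are revealed when it arrives. On each arrival the algorithm may irrevocably open further facilities, and it must at once connect the new client to at least $k$ distinct open facilities, without knowledge of future clients. The cost of a solution is the sum of the opening costs of all opened facilities and of all connecting costs paid. Let $\mathrm{Opt}$ denote the minimum cost of an offline solution, that is, of a set of opened facilities together with, for each client of the sequence, a set of at least $k$ opened facilities to which it is connected. A randomized online algorithm is $c$-competitive if, for all opening costs and every client sequence of length at most $n$ (fixed in advance by an oblivious adversary), its expected cost is at most $c\cdot\mathrm{Opt}$; its solution is always feasible. **Theorem.** There is an $O(\log(kn)\log m)$-competitive randomized online algorithm for online non-metric multi-facility location. Precisely: there is an absolute constant $C>0$ such that for all integers $m,n,k$ with $n\ge 0$ and $1\le k\le m$ there is a randomized online algorithm that, on all inputs with $m$ facilities, at most $n$ clients and $k$ required connections, is $c$-competitive with $$c=C\cdot\log(kn+1)\cdot\log(m+1).$$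 -/

import Mathlib

open scoped NNReal

namespace MultiFacility

/-- The (arbitrary, not necessarily metric) costs of one object to each of the `m` facilities:
either the opening costs of the facilities, or the connecting costs of one client. -/
abbrev CostVector (m : ℕ) : Type := Fin m → ℝ≥0

/-- A purchase for the clients in the list `σ` (the list of their vectors of connecting costs, in
order of arrival): the set of opened facilities, and for each client the set of facilities to which
it is connected. -/
structure Purchase (m : ℕ) (σ : List (CostVector m)) where
  opened : Finset (Fin m)
  connected : Fin σ.length → Finset (Fin m)

/-- Every client is connected to at least `k` facilities, all of which are open. -/
def Purchase.IsFeasible {m : ℕ} {σ : List (CostVector m)} (k : ℕ) (S : Purchase m σ) : Prop :=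
  ∀ i, k ≤ (S.connected i).card ∧ S.connected i ⊆ S.opened

/-- Total opening cost plus total connecting cost. -/
def Purchase.cost {m : ℕ} {σ : List (CostVector m)} (f : CostVector m) (S : Purchase m σ) : ℝ :=
  ∑ j ∈ S.opened, (f j : ℝ) + ∑ i, ∑ j ∈ S.connected i, (σ.get i j : ℝ)

/-- The cost of an optimal offline solution, for opening costs `f` and client sequence `σ`. -/
noncomputable def optCost {m : ℕ} (k : ℕ) (f : CostVector m) (σ : List (CostVector m)) : ℝ :=
  sInf {x : ℝ | ∃ S : Purchase m σ, S.IsFeasible k ∧ S.cost f = x}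

/-- The optimal offline cost is attained as soon as there are at least `k` facilities. -/
theorem optCost_isLeast {m k : ℕ} (hkm : k ≤ m) (f : CostVector m) (σ : List (CostVector m)) :
    IsLeast {x : ℝ | ∃ S : Purchase m σ, S.IsFeasible k ∧ S.cost f = x} (optCost k f σ) := by
  have hfin : {x : ℝ | ∃ S : Purchase m σ, S.IsFeasible k ∧ S.cost f = x}.Finite := by
    refine (Set.finite_range
      (fun p : Finset (Fin m) × (Fin σ.length → Finset (Fin m)) =>
        Purchase.cost f (⟨p.1, p.2⟩ : Purchase m σ))).subset ?_
    rintro x ⟨S, -, rfl⟩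
    exact ⟨(S.opened, S.connected), rfl⟩
  have hne : {x : ℝ | ∃ S : Purchase m σ, S.IsFeasible k ∧ S.cost f = x}.Nonempty :=
    ⟨_, ⟨Finset.univ, fun _ => Finset.univ⟩, fun _ => by simpa using hkm, rfl⟩
  exact ⟨hne.csInf_mem hfin, fun x hx => csInf_le hfin.bddBelow hx⟩

/-- A randomized online algorithm for `m` facilities in which every client has to be connected to
at least `k` open facilities: a random variable, on a probability space `Ω`, whose values are
deterministic online algorithms.

When a client arrives, the algorithm knows the opening costs `f` and the list `h` of the vectors of
connecting costs of all clients that have arrived so far, the newly arrived client being the last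
one. It irrevocably opens the facilities in `opens ω f h` (in addition to those opened earlier) and
connects the new client to the facilities in `connects ω f h`. -/
structure RandomizedOnlineAlgorithm (m k : ℕ) where
  Ω : Type
  [mΩ : MeasurableSpace Ω]
  P : MeasureTheory.Measure Ω
  [isProb : MeasureTheory.IsProbabilityMeasure P]
  opens : Ω → CostVector m → List (CostVector m) → Finset (Fin m)
  connects : Ω → CostVector m → List (CostVector m) → Finset (Fin m)
  measurable_opens : ∀ f h (D : Finset (Fin m)), MeasurableSet {ω | opens ω f h = D}
  measurable_connects : ∀ f h (D : Finset (Fin m)), MeasurableSet {ω | connects ω f h = D}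
  /-- On arrival a client is connected to at least `k` facilities. -/
  card_connects : ∀ ω f h, h ≠ [] → k ≤ (connects ω f h).card
  /-- These facilities are open by then: each was opened on the arrival of the present client
  or of an earlier one. -/
  connects_open : ∀ ω f h, h ≠ [] →
    ∀ j ∈ connects ω f h, ∃ t < h.length, j ∈ opens ω f (h.take (t + 1))

namespace RandomizedOnlineAlgorithm

variable {m k : ℕ} (A : RandomizedOnlineAlgorithm m k)

instance : MeasurableSpace A.Ω := A.mΩ

instance : MeasureTheory.IsProbabilityMeasure A.P := A.isProb

/-- What the algorithm, with random outcome `ω`, has purchased once the clients `σ` have arrived. -/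
def run (ω : A.Ω) (f : CostVector m) (σ : List (CostVector m)) : Purchase m σ where
  opened := (Finset.range σ.length).biUnion fun t => A.opens ω f (σ.take (t + 1))
  connected := fun i => A.connects ω f (σ.take (i + 1))

/-- The algorithm is `c`-competitive, against an oblivious adversary, on all inputs with at most
`n` clients: for all opening costs and every sequence of at most `n` clients, its expected cost is
at most `c` times the cost of an optimal offline solution. -/
def IsCompetitive (n : ℕ) (c : ℝ) : Prop :=
  ∀ (f : CostVector m) (σ : List (CostVector m)), σ.length ≤ n →
    MeasureTheory.Integrable (fun ω => (A.run ω f σ).cost f) A.P ∧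
      ∫ ω, (A.run ω f σ).cost f ∂A.P ≤ c * optCost k f σ

end RandomizedOnlineAlgorithm

end MultiFacility

namespace MultiFacility

open Finset MeasureTheory

/-! The algorithm is a primal-dual scheme for the linear relaxation, followed by threshold rounding.
As the radius `s` of an arriving client grows, the client pays `s - c j` to each facility it has
reached, until the `budget` of that facility is exhausted. The radius stops as soon as the
facilities reached are open to a total extent of `k`. For `a ≠ 0` the open fraction solves `a x' = x
+ 1/m` and rises from 0 to 1 exactly over the budget `a log (m + 1)`.

`clientValue` is the dual gain of a client, and everything is measured by it. The fractional opening
cost grows by at most twice this value (`sum_mul_openFraction_sub_le`). Connecting to `k` facilities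
within the radius, among them all saturated ones, costs at most this value
(`sum_connecting_le_clientValue`). Conversely, it is at most the connecting cost to any `k`
facilities plus the payments made to them (`clientValue_le`); as payments never exceed the budgets,
the values sum to `O(log m)` times the optimum (`totalValue_le`).

For the rounding, each facility draws one uniform threshold, kept forever, and is opened once the
scaled fraction `A x` exceeds it, where `A = 2 + 2 log (n + 1)`. A Chernoff bound shows that a
client remains unserved with probability at most `1 / (n + 1)` (`volume_real_not_isServed_le`). Such
a client buys its `k` cheapest facilities, at a cost of at most the optimum, so all fallbacks
together cost at most one optimum in expectation. The resulting ratio is `O(log (n + 1) log (m +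
1))`, and `n ≤ k n`. -/

/-! ### Payments and open fractions -/

/-- The total payment after which a facility with opening cost `a` is completely open. -/
noncomputable def budget (m : ℕ) (a : ℝ) : ℝ := a * Real.log ((m : ℝ) + 1)

/-- The fraction to which a facility with opening cost `a` is open after a total payment `t`. -/
noncomputable def openFraction (m : ℕ) (a t : ℝ) : ℝ :=
  if a = 0 then 1 else (Real.exp (t / a) - 1) / m

theorem log_card_add_one_nonneg (m : ℕ) : 0 ≤ Real.log ((m : ℝ) + 1) :=
  Real.log_nonneg (by linarith [(Nat.cast_nonneg m : (0 : ℝ) ≤ m)])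

theorem budget_nonneg (m : ℕ) {a : ℝ} (ha : 0 ≤ a) : 0 ≤ budget m a :=
  mul_nonneg ha (log_card_add_one_nonneg m)

theorem continuous_openFraction (m : ℕ) (a : ℝ) : Continuous (openFraction m a) := by
  unfold openFraction
  split_ifs <;> fun_prop

theorem monotone_openFraction (m : ℕ) {a : ℝ} (ha : 0 ≤ a) : Monotone (openFraction m a) := by
  intro t t' h
  unfold openFraction
  split_ifs
  · exact le_rfl
  · gcongr

theorem openFraction_nonneg (m : ℕ) {a t : ℝ} (ha : 0 ≤ a) (ht : 0 ≤ t) :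
    0 ≤ openFraction m a t := by
  unfold openFraction
  split_ifs
  · exact zero_le_one
  · have : 1 ≤ Real.exp (t / a) := Real.one_le_exp (by positivity)
    have h : 0 ≤ Real.exp (t / a) - 1 := by linarith
    positivity

theorem openFraction_budget {m : ℕ} (hm : 0 < m) (a : ℝ) :
    openFraction m a (budget m a) = 1 := by
  unfold openFraction budget
  split_ifs with h
  · rfl
  · have hm' : (0 : ℝ) < m := by exact_mod_cast hm
    rw [mul_div_cancel_left₀ _ h, Real.exp_log (by linarith)]
    field_simp
    ring

theorem mul_openFraction_zero (m : ℕ) (a : ℝ) : a * openFraction m a 0 = 0 := by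
  unfold openFraction
  split_ifs with h <;> simp [h]

theorem openFraction_le_one {m : ℕ} (hm : 0 < m) {a t : ℝ} (ha : 0 ≤ a) (ht : t ≤ budget m a) :
    openFraction m a t ≤ 1 :=
  (monotone_openFraction m ha ht).trans_eq (openFraction_budget hm a)

/-- Integrated form of `a x' = x + 1/m`: the fraction is convex in the payment, so its increase is
at most the slope at the right end times the length. -/
theorem mul_openFraction_sub_le (m : ℕ) {a t t' : ℝ} (ha : 0 ≤ a) (h : t ≤ t') :
    a * (openFraction m a t' - openFraction m a t) ≤
      (openFraction m a t' + 1 / m) * (t' - t) := by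
  unfold openFraction
  split_ifs with h0
  · have : 0 ≤ t' - t := by linarith
    simp only [sub_self, mul_zero]
    positivity
  · have ha' : 0 < a := lt_of_le_of_ne ha (Ne.symm h0)
    have h1 : 1 - (t' - t) / a ≤ Real.exp (t / a - t' / a) := by
      have := Real.add_one_le_exp (t / a - t' / a)
      have h2 : t / a - t' / a = -((t' - t) / a) := by ring
      linarith
    rw [Real.exp_sub, le_div_iff₀ (Real.exp_pos _)] at h1
    have h3 : a * (Real.exp (t' / a) - Real.exp (t / a)) ≤ Real.exp (t' / a) * (t' - t) := by
      have h4 := mul_le_mul_of_nonneg_left h1 ha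
      have h5 : a * ((1 - (t' - t) / a) * Real.exp (t' / a)) =
          a * Real.exp (t' / a) - (t' - t) * Real.exp (t' / a) := by
        field_simp
      linarith
    calc _ = a * (Real.exp (t' / a) - Real.exp (t / a)) / m := by ring
      _ ≤ Real.exp (t' / a) * (t' - t) / m := by gcongr
      _ = _ := by ring

/-! ### The radius and the dual value of one client -/

section Client

variable {m : ℕ} (k : ℕ) (f : CostVector m) (t : Fin m → ℝ) (c : CostVector m)

/-- The payments once a client with connecting costs `c` and radius `s` has contributed to the
earlier payments `t`. -/
noncomputable def payment (s : ℝ) (j : Fin m) : ℝ :=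
  min (budget m (f j)) (t j + max 0 (s - c j))

/-- The radii within which facilities are open to a total extent of at least `k`. -/
def coveringRadii : Set ℝ :=
  {s | 0 ≤ s ∧ ∃ D : Finset (Fin m), (∀ j ∈ D, (c j : ℝ) ≤ s) ∧
    (k : ℝ) ≤ ∑ j ∈ D, openFraction m (f j) (payment f t c s j)}

/-- The radius of a client: the least radius that covers it. -/
noncomputable def radius : ℝ := sInf (coveringRadii k f t c)

/-- The radius of the client at which facility `j` becomes completely open. -/
noncomputable def saturationRadius (j : Fin m) : ℝ := c j + (budget m (f j) - t j)

/-- The facilities that are completely open strictly before the radius of the client is reached. -/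
noncomputable def saturated : Finset (Fin m) :=
  univ.filter fun j => saturationRadius f t c j < radius k f t c

/-- The integral of `k` minus the number of facilities that are completely open, as the radius of the
client grows from `0` to its final value. -/
noncomputable def clientValue : ℝ :=
  ∑ j ∈ saturated k f t c, saturationRadius f t c j +
    ((k : ℝ) - (saturated k f t c).card) * radius k f t c

/-- Payments never exceed the budgets. -/
def WithinBudget : Prop := ∀ j, 0 ≤ t j ∧ t j ≤ budget m (f j)

variable {k f t c}

theorem payment_nonneg (ht : WithinBudget f t) (s : ℝ) (j : Fin m) : 0 ≤ payment f t c s j :=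
  le_min (budget_nonneg m (f j).2) (add_nonneg (ht j).1 (le_max_left _ _))

theorem payment_le (s : ℝ) (j : Fin m) : payment f t c s j ≤ budget m (f j) := min_le_left _ _

theorem le_payment (ht : WithinBudget f t) (s : ℝ) (j : Fin m) : t j ≤ payment f t c s j :=
  le_min (ht j).2 (by linarith [le_max_left 0 (s - c j)])

theorem withinBudget_payment (ht : WithinBudget f t) (s : ℝ) :
    WithinBudget f (payment f t c s) :=
  fun j => ⟨payment_nonneg ht s j, payment_le s j⟩

theorem payment_of_saturationRadius_le {s : ℝ} {j : Fin m}
    (h : saturationRadius f t c j ≤ s) : payment f t c s j = budget m (f j) := by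
  unfold saturationRadius at h
  exact min_eq_left (by linarith [le_max_right 0 (s - c j)])

theorem le_saturationRadius (ht : WithinBudget f t) (j : Fin m) :
    (c j : ℝ) ≤ saturationRadius f t c j := by
  unfold saturationRadius
  linarith [(ht j).2]

/-- Closedness makes the infimum defining `radius` attained. For each of the finitely many `D` the
conditions are closed, since payments depend continuously on the radius. -/
theorem isClosed_coveringRadii : IsClosed (coveringRadii k f t c) := by
  have h : coveringRadii k f t c = Set.Ici 0 ∩ ⋃ D : Finset (Fin m),
      {s | (∀ j ∈ D, (c j : ℝ) ≤ s) ∧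
        (k : ℝ) ≤ ∑ j ∈ D, openFraction m (f j) (payment f t c s j)} := by
    ext s
    simp [coveringRadii]
  rw [h]
  refine isClosed_Ici.inter (isClosed_iUnion_of_finite fun D => ?_)
  have h1 : IsClosed {s : ℝ | ∀ j ∈ D, (c j : ℝ) ≤ s} := by
    simp only [Set.ofPred_forall]
    exact isClosed_iInter fun j => isClosed_iInter fun _ => isClosed_Ici
  have h2 : Continuous fun s => ∑ j ∈ D, openFraction m (f j) (payment f t c s j) := by
    refine continuous_finsetSum _ fun j _ => (continuous_openFraction m (f j)).comp ?_
    unfold payment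
    fun_prop
  exact h1.inter (isClosed_le continuous_const h2)

theorem card_le_mem_coveringRadii (hm : 0 < m) (ht : WithinBudget f t) {s : ℝ} (hs : 0 ≤ s)
    {D : Finset (Fin m)} (hk : k ≤ D.card) (hD : ∀ j ∈ D, saturationRadius f t c j ≤ s) :
    s ∈ coveringRadii k f t c := by
  refine ⟨hs, D, fun j hj => (le_saturationRadius ht j).trans (hD j hj), ?_⟩
  rw [sum_congr rfl fun j hj => by
    rw [payment_of_saturationRadius_le (hD j hj), openFraction_budget hm]]
  simpa using hk

theorem radius_mem (hm : 0 < m) (hkm : k ≤ m) (ht : WithinBudget f t) :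
    radius k f t c ∈ coveringRadii k f t c := by
  refine isClosed_coveringRadii.csInf_mem ?_ ⟨0, fun s hs => hs.1⟩
  have hnn : ∀ j, 0 ≤ saturationRadius f t c j := fun j =>
    (c j).2.trans (le_saturationRadius ht j)
  exact ⟨∑ j, saturationRadius f t c j,
    card_le_mem_coveringRadii hm ht (sum_nonneg fun j _ => hnn j) (D := univ) (by simpa using hkm)
      fun j hj => single_le_sum (f := saturationRadius f t c) (fun i _ => hnn i) hj⟩

theorem notMem_of_lt_radius {s : ℝ} (hs : s < radius k f t c) : s ∉ coveringRadii k f t c :=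
  fun h => (csInf_le ⟨0, fun _ hs => hs.1⟩ h).not_gt hs

/-- With `k` facilities saturated strictly before the radius, the largest of their saturation radii
would already cover the client. -/
theorem card_saturated_lt (hm : 0 < m) (hk : 1 ≤ k) (ht : WithinBudget f t) :
    (saturated k f t c).card < k := by
  by_contra! h
  have hne : (saturated k f t c).Nonempty := card_pos.1 (by omega)
  obtain ⟨i, hi, hmax⟩ := exists_max_image _ (saturationRadius f t c) hne
  exact notMem_of_lt_radius (mem_filter.1 hi).2
    (card_le_mem_coveringRadii hm ht ((c i).2.trans (le_saturationRadius ht i)) h hmax)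

/-- Smaller radii do not cover the client; let them tend to the radius from below. The strict
inequality matters: facilities at distance exactly `radius` may be partly open already, and make the
covered extent jump past `k`. -/
theorem sum_openFraction_le :
    ∑ j with (c j : ℝ) < radius k f t c,
      openFraction m (f j) (payment f t c (radius k f t c) j) ≤ k := by
  set τ := radius k f t c
  rcases (univ.filter fun j => (c j : ℝ) < τ).eq_empty_or_nonempty with h | ⟨i, hi⟩
  · simp [h]
  have hcont : Continuous fun s => ∑ j with (c j : ℝ) < τ,
      openFraction m (f j) (payment f t c s j) := by
    refine continuous_finsetSum _ fun j _ => (continuous_openFraction m (f j)).comp ?_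
    unfold payment
    fun_prop
  refine le_of_tendsto (hcont.continuousWithinAt (s := Set.Iio τ)).tendsto ?_
  have hev : ∀ᶠ s in nhdsWithin τ (Set.Iio τ), ∀ j, (c j : ℝ) < τ → (c j : ℝ) ≤ s := by
    rw [Filter.eventually_all]
    intro j
    by_cases hj : (c j : ℝ) < τ
    · filter_upwards [Ioo_mem_nhdsLT hj] with s hs _ using hs.1.le
    · exact Filter.Eventually.of_forall fun s h => absurd h hj
  filter_upwards [hev, self_mem_nhdsWithin] with s hs hlt
  by_contra! hgt
  exact notMem_of_lt_radius hlt
    ⟨(c i).2.trans (hs i (mem_filter.1 hi).2), _, fun j hj => hs j (mem_filter.1 hj).2, hgt.le⟩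

theorem radius_nonneg (hm : 0 < m) (hkm : k ≤ m) (ht : WithinBudget f t) :
    0 ≤ radius k f t c := (radius_mem hm hkm ht).1

theorem le_sum_openFraction (hm : 0 < m) (hkm : k ≤ m) (ht : WithinBudget f t) :
    (k : ℝ) ≤ ∑ j with (c j : ℝ) ≤ radius k f t c,
      openFraction m (f j) (payment f t c (radius k f t c) j) := by
  obtain ⟨-, D, hD, h⟩ := radius_mem (c := c) hm hkm ht
  refine h.trans (sum_le_sum_of_subset_of_nonneg (fun j hj => ?_) fun j _ _ =>
    openFraction_nonneg m (f j).2 (payment_nonneg ht _ j))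
  exact mem_filter.2 ⟨mem_univ j, hD j hj⟩

theorem clientValue_nonneg (hm : 0 < m) (hk : 1 ≤ k) (hkm : k ≤ m) (ht : WithinBudget f t) :
    0 ≤ clientValue k f t c := by
  have h : ((saturated k f t c).card : ℝ) ≤ k := by
    exact_mod_cast (card_saturated_lt hm hk ht).le
  exact add_nonneg (sum_nonneg fun j _ => (c j).2.trans (le_saturationRadius ht j))
    (mul_nonneg (by linarith) (radius_nonneg hm hkm ht))

/-- The value of a client is at most its connecting cost to any `k` facilities, plus what it pays
for opening them. -/
theorem clientValue_le (hm : 0 < m) (hkm : k ≤ m) (ht : WithinBudget f t)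
    {K : Finset (Fin m)} (hK : k ≤ K.card) :
    clientValue k f t c ≤
      ∑ j ∈ K, ((c j : ℝ) + (payment f t c (radius k f t c) j - t j)) := by
  set τ := radius k f t c with hτ
  have hτ0 : 0 ≤ τ := radius_nonneg hm hkm ht
  -- Each saturated facility lowers the integrand `k` by one from its saturation radius up to `τ`.
  have h1 : clientValue k f t c = k * τ + ∑ j, min (saturationRadius f t c j - τ) 0 := by
    have h2 : ∑ j, min (saturationRadius f t c j - τ) 0 =
        ∑ j ∈ saturated k f t c, (saturationRadius f t c j - τ) := by
      rw [saturated, sum_filter]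
      refine sum_congr rfl fun j _ => ?_
      split_ifs with h
      · exact min_eq_left (by linarith)
      · exact min_eq_right (by linarith)
    rw [h2, sum_sub_distrib, clientValue, sum_const, nsmul_eq_mul]
    ring
  -- All terms are nonpositive, so those outside `K` may be dropped. Each `j ∈ K` then accounts for
  -- the smaller of `τ` and its saturation radius, which its connecting cost and payment cover.
  have h3 : ∑ j, min (saturationRadius f t c j - τ) 0 ≤
      ∑ j ∈ K, min (saturationRadius f t c j - τ) 0 := by
    rw [← sum_add_sum_compl K]
    linarith [sum_nonpos (s := Kᶜ) fun j _ => min_le_right (saturationRadius f t c j - τ) 0]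
  have h4 : (k : ℝ) * τ ≤ ∑ _j ∈ K, τ := by
    rw [sum_const, nsmul_eq_mul]
    gcongr
  rw [h1]
  refine (add_le_add h4 h3).trans ?_
  rw [← sum_add_distrib]
  refine sum_le_sum fun j _ => ?_
  unfold payment saturationRadius
  have hc : (0 : ℝ) ≤ c j := (c j).2
  rcases min_cases (budget m (f j)) (t j + max 0 (τ - c j)) with h | h <;>
  rcases min_cases ((c j : ℝ) + (budget m (f j) - t j) - τ) 0 with h' | h' <;>
  rcases max_cases 0 (τ - c j) with h'' | h'' <;> linarith

/-- The fractional opening cost increases by at most twice the value of the client. -/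
theorem sum_mul_openFraction_sub_le (hm : 0 < m) (hk : 1 ≤ k) (hkm : k ≤ m)
    (ht : WithinBudget f t) :
    ∑ j, (f j : ℝ) * (openFraction m (f j) (payment f t c (radius k f t c) j) -
      openFraction m (f j) (t j)) ≤ 2 * clientValue k f t c := by
  set τ := radius k f t c with hτ
  set x : Fin m → ℝ := fun j => openFraction m (f j) (payment f t c τ j) with hx
  have hτ0 : 0 ≤ τ := radius_nonneg hm hkm ht
  have hx0 : ∀ j, 0 ≤ x j := fun j => openFraction_nonneg m (f j).2 (payment_nonneg ht _ j)
  have hm1 : (1 : ℝ) ≤ m := by exact_mod_cast hm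
  have hinv : (1 : ℝ) / m ≤ 1 := by rw [div_le_one (by linarith)]; exact hm1
  set Z := saturated k f t c with hZ
  set N := univ.filter fun j => (c j : ℝ) < τ with hN
  have hZN : Z ⊆ N := fun j hj => mem_filter.2
    ⟨mem_univ j, (le_saturationRadius ht j).trans_lt (mem_filter.1 hj).2⟩
  have hxZ : ∀ j ∈ Z, x j = 1 := fun j hj => by
    simp only [hx]
    rw [payment_of_saturationRadius_le (mem_filter.1 hj).2.le, openFraction_budget hm]
  have hcard : (Z.card : ℝ) + 1 ≤ k := by exact_mod_cast card_saturated_lt hm hk ht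
  have hsum : ∑ j ∈ N \ Z, x j ≤ k - Z.card := by
    have h1 : ∑ j ∈ N, x j ≤ k := sum_openFraction_le
    rw [← sum_sdiff hZN, sum_congr rfl hxZ] at h1
    simp only [sum_const, nsmul_eq_mul, mul_one] at h1
    linarith
  have hstep : ∀ j, (f j : ℝ) * (x j - openFraction m (f j) (t j)) ≤
      (x j + 1 / m) * (payment f t c τ j - t j) := fun j =>
    mul_openFraction_sub_le m (f j).2 (le_payment ht τ j)
  -- Facilities not strictly inside the radius receive no payment.
  have hout : ∀ j ∈ Nᶜ, (f j : ℝ) * (x j - openFraction m (f j) (t j)) ≤ 0 := by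
    intro j hj
    have hj' : τ ≤ c j := by simpa [hN] using hj
    have h0 : payment f t c τ j - t j ≤ 0 := by
      unfold payment
      rw [max_eq_left (by linarith)]
      linarith [min_le_right (budget m (f j)) (t j + 0)]
    exact (hstep j).trans (mul_nonpos_of_nonneg_of_nonpos
      (by have := hx0 j; positivity) h0)
  have hZle : ∀ j ∈ Z, (f j : ℝ) * (x j - openFraction m (f j) (t j)) ≤
      2 * saturationRadius f t c j := by
    intro j hj
    have h1 : payment f t c τ j - t j ≤ saturationRadius f t c j := by
      have := payment_le (t := t) (c := c) (f := f) τ j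
      unfold saturationRadius
      linarith [(c j).2]
    refine (hstep j).trans (mul_le_mul ?_ h1 ?_ (by norm_num))
    · rw [hxZ j hj]; linarith
    · linarith [le_payment (c := c) ht τ j]
  have hle : ∀ j ∈ N \ Z, (f j : ℝ) * (x j - openFraction m (f j) (t j)) ≤
      (x j + 1 / m) * τ := by
    intro j hj
    refine (hstep j).trans (mul_le_mul_of_nonneg_left ?_ (by have := hx0 j; positivity))
    have h1 := min_le_right (budget m (f j)) (t j + max 0 (τ - c j))
    have h2 : max 0 (τ - c j) ≤ τ := max_le hτ0 (by linarith [(c j).2])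
    unfold payment
    linarith
  -- The terms `1 / m` add up to at most 1, hence to at most `k - Z.card` by `card_saturated_lt`.
  -- Together with `hsum` this gives the factor 2.
  have hcount : ((N \ Z).card : ℝ) * (1 / m) ≤ 1 := by
    have : ((N \ Z).card : ℝ) ≤ m := by
      exact_mod_cast (card_le_univ (N \ Z)).trans_eq (Fintype.card_fin m)
    rw [mul_one_div, div_le_one (by linarith)]
    exact this
  rw [← sum_add_sum_compl N, ← sum_sdiff hZN]
  have h1 := sum_le_sum hle
  have h2 := sum_le_sum hZle
  have h3 := sum_nonpos hout
  rw [← sum_mul, sum_add_distrib, sum_const, nsmul_eq_mul] at h1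
  rw [← mul_sum] at h2
  have h4 : (∑ j ∈ N \ Z, x j + ((N \ Z).card : ℝ) * (1 / m)) * τ ≤
      (2 * (k - Z.card)) * τ := mul_le_mul_of_nonneg_right (by linarith) hτ0
  have h5 : clientValue k f t c = ∑ j ∈ Z, saturationRadius f t c j + (k - Z.card) * τ := rfl
  rw [h5]
  linarith

/-- The saturated facilities lie within their saturation radii, and the remaining `k` minus their
number within the radius; these bounds add up to the value. -/
theorem sum_connecting_le_clientValue (ht : WithinBudget f t)
    {T : Finset (Fin m)} (hZ : saturated k f t c ⊆ T) (hcard : T.card = k)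
    (hT : ∀ j ∈ T, (c j : ℝ) ≤ radius k f t c) :
    ∑ j ∈ T, (c j : ℝ) ≤ clientValue k f t c := by
  rw [← sum_sdiff hZ, add_comm]
  refine add_le_add (sum_le_sum fun j _ => le_saturationRadius ht j) ?_
  refine (sum_le_card_nsmul _ _ _ fun j hj => hT j (mem_sdiff.1 hj).1).trans_eq ?_
  rw [nsmul_eq_mul, card_sdiff_of_subset hZ, Nat.cast_sub (card_le_card hZ), hcard]

end Client

/-! ### Uniform thresholds and a Chernoff bound -/

section Rounding

variable {m : ℕ}

theorem volume_real_setOf_lt {p : ℝ} (hp : p ≤ 1) :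
    (volume : Measure unitInterval).real {θ | (θ : ℝ) < p} = max p 0 := by
  rcases le_or_gt p 0 with h | h
  · have : {θ : unitInterval | (θ : ℝ) < p} = ∅ := by
      ext θ
      simpa using h.trans θ.2.1
    simp [this, h]
  · have : {θ : unitInterval | (θ : ℝ) < p} = Set.Iio ⟨p, h.le, hp⟩ := rfl
    rw [this, measureReal_def, unitInterval.volume_Iio]
    simp [h.le]

theorem measurableSet_setOf_coord_lt (j : Fin m) (p : ℝ) :
    MeasurableSet {ω : Fin m → unitInterval | (ω j : ℝ) < p} :=
  measurableSet_lt (measurable_subtype_coe.comp (measurable_pi_apply j)) measurable_const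

theorem volume_real_setOf_coord_lt_le (j : Fin m) {p : ℝ} (hp : 0 ≤ p) :
    (volume : Measure (Fin m → unitInterval)).real {ω | (ω j : ℝ) < p} ≤ p := by
  rcases le_or_gt p 1 with h | h
  · have h1 := (measurePreserving_eval (fun _ : Fin m => (volume : Measure unitInterval))
      j).measureReal_preimage (s := {θ : unitInterval | (θ : ℝ) < p})
      (measurableSet_lt measurable_subtype_coe measurable_const).nullMeasurableSet
    rw [volume_real_setOf_lt h, max_eq_left hp] at h1
    exact h1.le
  · exact measureReal_le_one.trans h.le

/-- A Chernoff bound for the lower tail of a sum of independent Bernoulli variables. -/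
theorem volume_real_card_lt_le (R : Finset (Fin m)) (p : Fin m → ℝ)
    (hp : ∀ j ∈ R, 0 ≤ p j ∧ p j ≤ 1) (r : ℕ) :
    (volume : Measure (Fin m → unitInterval)).real
      {ω | (R.filter fun j => (ω j : ℝ) < p j).card < r} ≤
      Real.exp (r - (∑ j ∈ R, p j) / 2) := by
  -- Exponential moment method: the product of the `g j` is `exp (-count)`, its integral factorizes
  -- by independence, and Markov's inequality costs a factor `exp r`.
  set g : Fin m → unitInterval → ℝ := fun j θ =>
    if j ∈ R then 1 - {θ : unitInterval | (θ : ℝ) < p j}.indicator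
      (fun _ => 1 - Real.exp (-1)) θ else 1 with hg
  have hprod : ∀ ω : Fin m → unitInterval, ∏ j, g j (ω j) =
      Real.exp (-((R.filter fun j => (ω j : ℝ) < p j).card : ℝ)) := by
    intro ω
    have h1 : ∏ j, g j (ω j) =
        ∏ j ∈ R, if (ω j : ℝ) < p j then Real.exp (-1) else 1 := by
      simp only [hg, prod_ite_mem, univ_inter]
      refine prod_congr rfl fun j _ => ?_
      by_cases h : (ω j : ℝ) < p j <;> simp [h]
    rw [h1, ← prod_filter, prod_const, ← Real.exp_nat_mul]
    congr 1
    ring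
  have hgi : ∀ j, Integrable (g j) := by
    intro j
    simp only [hg]
    split_ifs
    · exact (integrable_const _).sub ((integrable_const _).indicator
        (measurableSet_lt measurable_subtype_coe measurable_const))
    · exact integrable_const _
  have hint : ∫ ω : Fin m → unitInterval, ∏ j, g j (ω j) ≤
      Real.exp (-(∑ j ∈ R, p j) / 2) := by
    rw [integral_fintype_prod_volume_eq_prod]
    have h2 : ∀ j, ∫ θ, g j θ = if j ∈ R then 1 - p j * (1 - Real.exp (-1)) else 1 := by
      intro j
      simp only [hg]
      split_ifs with hj
      · rw [integral_sub (integrable_const _) ((integrable_const _).indicator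
          (measurableSet_lt measurable_subtype_coe measurable_const)),
          integral_indicator_const _
          (measurableSet_lt measurable_subtype_coe measurable_const),
          volume_real_setOf_lt (hp j hj).2, max_eq_left (hp j hj).1]
        simp
      · simp
    rw [prod_congr rfl fun j _ => h2 j, prod_ite_mem, univ_inter, neg_div, sum_div,
      ← sum_neg_distrib, Real.exp_sum]
    -- Hence `1 - p (1 - exp (-1)) ≤ 1 - p / 2 ≤ exp (-p / 2)`.
    have he : Real.exp (-1) ≤ 1 / 2 := by
      rw [Real.exp_neg, one_div]
      exact inv_anti₀ (by norm_num) (by linarith [Real.add_one_le_exp 1])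
    refine prod_le_prod (fun j hj => ?_) fun j hj => ?_
    · nlinarith [(hp j hj).1, (hp j hj).2, Real.exp_pos (-1)]
    · have := Real.add_one_le_exp (-(p j / 2))
      nlinarith [(hp j hj).1]
  have hmarkov : (volume : Measure (Fin m → unitInterval)).real
      {ω | (R.filter fun j => (ω j : ℝ) < p j).card < r} ≤
      ∫ ω : Fin m → unitInterval, Real.exp r * ∏ j, g j (ω j) := by
    have hmeas : MeasurableSet {ω : Fin m → unitInterval |
        (R.filter fun j => (ω j : ℝ) < p j).card < r} := by
      have : Measurable fun ω : Fin m → unitInterval =>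
          (R.filter fun j => (ω j : ℝ) < p j).card := by
        simp only [card_filter]
        exact Finset.measurable_sum _ fun j _ =>
          Measurable.ite (measurableSet_setOf_coord_lt j _) measurable_const measurable_const
      exact measurableSet_lt this measurable_const
    rw [← integral_indicator_one hmeas]
    refine integral_mono ((integrable_const _).indicator hmeas)
      ((Integrable.fintype_prod hgi).const_mul _) fun ω => ?_
    simp only [hprod, ← Real.exp_add]
    refine Set.indicator_apply_le' (fun hω => ?_) fun _ => (Real.exp_pos _).le
    refine Real.one_le_exp ?_
    have : ((R.filter fun j => (ω j : ℝ) < p j).card : ℝ) ≤ r := by exact_mod_cast (le_of_lt hω)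
    linarith
  refine hmarkov.trans ?_
  rw [integral_const_mul, show (r : ℝ) - (∑ j ∈ R, p j) / 2 = r + -(∑ j ∈ R, p j) / 2 by ring,
    Real.exp_add]
  exact mul_le_mul_of_nonneg_left hint (Real.exp_pos _).le

end Rounding

/-! ### Summation over the clients -/

section State

variable {m : ℕ} (k : ℕ) (f : CostVector m)

/-- The payments after the clients `σ` have arrived. -/
noncomputable def payments (σ : List (CostVector m)) : Fin m → ℝ :=
  σ.foldl (fun t c => payment f t c (radius k f t c)) 0

theorem payments_concat (σ : List (CostVector m)) (c : CostVector m) :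
    payments k f (σ ++ [c]) =
      payment f (payments k f σ) c (radius k f (payments k f σ) c) := by
  simp [payments, List.foldl_append]

theorem withinBudget_payments (σ : List (CostVector m)) :
    WithinBudget f (payments k f σ) := by
  induction σ using List.reverseRecOn with
  | nil => exact fun j => ⟨le_rfl, budget_nonneg m (f j).2⟩
  | append_singleton σ c ih =>
    rw [payments_concat]
    exact withinBudget_payment ih _

theorem payments_le_append (σ l : List (CostVector m)) (j : Fin m) :
    payments k f σ j ≤ payments k f (σ ++ l) j := by
  induction l using List.reverseRecOn with
  | nil => simp
  | append_singleton l c ih =>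
    rw [← List.append_assoc, payments_concat]
    exact ih.trans (le_payment (withinBudget_payments k f _) _ j)

theorem payments_take_le (σ : List (CostVector m)) (i : ℕ) (j : Fin m) :
    payments k f (σ.take i) j ≤ payments k f σ j := by
  conv_rhs => rw [← List.take_append_drop i σ]
  exact payments_le_append k f _ _ j

theorem payments_take_succ (σ : List (CostVector m)) (i : Fin σ.length) :
    payments k f (σ.take (i + 1)) = payment f (payments k f (σ.take i)) (σ.get i)
      (radius k f (payments k f (σ.take i)) (σ.get i)) := by
  rw [← payments_concat, List.get_eq_getElem, List.take_append_getElem]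

/-- The sum of the values of all clients. -/
noncomputable def totalValue (σ : List (CostVector m)) : ℝ :=
  ∑ i : Fin σ.length, clientValue k f (payments k f (σ.take i)) (σ.get i)

variable {k f}

theorem totalValue_nonneg (hk : 1 ≤ k) (hkm : k ≤ m) (σ : List (CostVector m)) :
    0 ≤ totalValue k f σ :=
  sum_nonneg fun _ _ => clientValue_nonneg (by omega) hk hkm (withinBudget_payments k f _)

theorem sum_mul_openFraction_le (hk : 1 ≤ k) (hkm : k ≤ m) (σ : List (CostVector m)) :
    ∑ j, (f j : ℝ) * openFraction m (f j) (payments k f σ j) ≤ 2 * totalValue k f σ := by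
  set F : ℕ → ℝ := fun i =>
    ∑ j, (f j : ℝ) * openFraction m (f j) (payments k f (σ.take i) j) with hF
  have h0 : F 0 = 0 := by
    simp only [hF, List.take_zero, payments, List.foldl_nil, Pi.zero_apply, mul_openFraction_zero,
      sum_const_zero]
  have h1 : F σ.length = ∑ i : Fin σ.length, (F (i + 1) - F i) := by
    rw [Fin.sum_univ_eq_sum_range (fun i => F (i + 1) - F i), sum_range_sub, h0, sub_zero]
  have h2 : F σ.length = ∑ j, (f j : ℝ) * openFraction m (f j) (payments k f σ j) := by
    simp [hF]
  rw [← h2, h1, totalValue, mul_sum]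
  refine sum_le_sum fun i _ => ?_
  simp only [hF, ← sum_sub_distrib, ← mul_sub, payments_take_succ]
  exact sum_mul_openFraction_sub_le (by omega) hk hkm (withinBudget_payments k f _)

/-- Weak duality: `clientValue_le` is applied to the connections of `S`, enlarged to `S.opened` in
the payment part. The payments to each facility telescope and stay within its budget. -/
theorem totalValue_le (hk : 1 ≤ k) (hkm : k ≤ m) {σ : List (CostVector m)}
    {S : Purchase m σ} (hS : S.IsFeasible k) :
    totalValue k f σ ≤ ∑ i, ∑ j ∈ S.connected i, (σ.get i j : ℝ) +
      Real.log ((m : ℝ) + 1) * ∑ j ∈ S.opened, (f j : ℝ) := by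
  set d : ℕ → Fin m → ℝ := fun i j =>
    payments k f (σ.take (i + 1)) j - payments k f (σ.take i) j with hd
  have hclient : ∀ i : Fin σ.length, clientValue k f (payments k f (σ.take i)) (σ.get i) ≤
      ∑ j ∈ S.connected i, (σ.get i j : ℝ) + ∑ j ∈ S.opened, d i j := by
    intro i
    have hw := withinBudget_payments k f (σ.take i)
    refine (clientValue_le (by omega) hkm hw (hS i).1).trans ?_
    rw [sum_add_distrib]
    gcongr
    simp only [hd, payments_take_succ]
    exact sum_le_sum_of_subset_of_nonneg (hS i).2 fun j _ _ =>
      sub_nonneg.2 (le_payment hw _ j)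
  refine (sum_le_sum fun i _ => hclient i).trans ?_
  rw [sum_add_distrib]
  gcongr
  rw [sum_comm, mul_sum]
  refine sum_le_sum fun j _ => ?_
  rw [Fin.sum_univ_eq_sum_range (fun i => d i j)]
  simp only [hd]
  rw [sum_range_sub (fun i => payments k f (σ.take i) j)]
  have h := (withinBudget_payments k f σ j).2
  simpa [payments, budget, mul_comm] using h

end State

theorem sum_biUnion_le_sum_sum {ι α : Type*} [DecidableEq α] {w : α → ℝ} (hw : ∀ a, 0 ≤ w a)
    (s : Finset ι) (E : ι → Finset α) :
    ∑ a ∈ s.biUnion E, w a ≤ ∑ i ∈ s, ∑ a ∈ E i, w a := by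
  classical
  induction s using Finset.induction_on with
  | empty => simp
  | insert i s hi ih =>
    rw [biUnion_insert, sum_insert hi]
    have h1 := sum_union_inter (s₁ := E i) (s₂ := s.biUnion E) (f := w)
    have h2 : 0 ≤ ∑ a ∈ E i ∩ s.biUnion E, w a := sum_nonneg fun a _ => hw a
    linarith

/-! ### The fallback and the rounding algorithm -/

section Algorithm

variable {m : ℕ} {k : ℕ}

theorem exists_cheapest (hkm : k ≤ m) (f c : CostVector m) :
    ∃ K : Finset (Fin m), K.card = k ∧ ∀ K' : Finset (Fin m), K'.card = k →
      ∑ j ∈ K, ((f j : ℝ) + c j) ≤ ∑ j ∈ K', ((f j : ℝ) + c j) := by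
  obtain ⟨K, hK, hmin⟩ := exists_min_image (powersetCard k (univ : Finset (Fin m)))
    (fun K => ∑ j ∈ K, ((f j : ℝ) + c j)) (powersetCard_nonempty.2 (by simpa using hkm))
  exact ⟨K, (mem_powersetCard.1 hK).2, fun K' hK' =>
    hmin K' (mem_powersetCard.2 ⟨subset_univ _, hK'⟩)⟩

/-- A set of `k` facilities that is cheapest to open and to connect to a single client. -/
noncomputable def cheapest (hkm : k ≤ m) (f c : CostVector m) : Finset (Fin m) :=
  (exists_cheapest hkm f c).choose

theorem card_cheapest (hkm : k ≤ m) (f c : CostVector m) : (cheapest hkm f c).card = k :=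
  (exists_cheapest hkm f c).choose_spec.1

theorem sum_cheapest_le_optCost (hkm : k ≤ m) (f : CostVector m) (σ : List (CostVector m))
    (i : Fin σ.length) :
    ∑ j ∈ cheapest hkm f (σ.get i), (f j : ℝ) + ∑ j ∈ cheapest hkm f (σ.get i), (σ.get i j : ℝ) ≤
      optCost k f σ := by
  obtain ⟨S, hS, hcost⟩ := (optCost_isLeast hkm f σ).1
  obtain ⟨K, hKS, hK⟩ := exists_subset_card_eq (hS i).1
  rw [← sum_add_distrib, ← hcost]
  refine ((exists_cheapest hkm f (σ.get i)).choose_spec.2 K hK).trans ?_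
  rw [sum_add_distrib]
  refine add_le_add (sum_le_sum_of_subset_of_nonneg (hKS.trans (hS i).2) fun j _ _ => (f j).2) ?_
  refine (sum_le_sum_of_subset_of_nonneg hKS fun j _ _ => (σ.get i j).2).trans ?_
  exact single_le_sum (f := fun i => ∑ j ∈ S.connected i, (σ.get i j : ℝ))
    (fun i _ => sum_nonneg fun j _ => (σ.get i j).2) (mem_univ i)

/-- Whether some `k` facilities of `O` within the radius of the client include all those that it
saturates. -/
def IsServed (k : ℕ) (f : CostVector m) (t : Fin m → ℝ) (c : CostVector m)
    (O : Finset (Fin m)) : Prop :=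
  ∃ T, saturated k f t c ⊆ T ∧ T ⊆ O.filter (fun j => (c j : ℝ) ≤ radius k f t c) ∧ T.card = k

open Classical in
/-- The facilities to which a client is connected if those in `O` are open. -/
noncomputable def links (hkm : k ≤ m) (f : CostVector m) (t : Fin m → ℝ) (c : CostVector m)
    (O : Finset (Fin m)) : Finset (Fin m) :=
  if h : IsServed k f t c O then h.choose else cheapest hkm f c

open Classical in
/-- The facilities opened for a client that cannot be served by those in `O`. -/
noncomputable def extraOpens (hkm : k ≤ m) (f : CostVector m) (t : Fin m → ℝ) (c : CostVector m)
    (O : Finset (Fin m)) : Finset (Fin m) :=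
  if IsServed k f t c O then ∅ else cheapest hkm f c

theorem card_links (hkm : k ≤ m) (f : CostVector m) (t : Fin m → ℝ) (c : CostVector m)
    (O : Finset (Fin m)) : (links hkm f t c O).card = k := by
  unfold links
  split_ifs with h
  · exact h.choose_spec.2.2
  · exact card_cheapest hkm f c

theorem links_subset (hkm : k ≤ m) (f : CostVector m) (t : Fin m → ℝ) (c : CostVector m)
    (O : Finset (Fin m)) : links hkm f t c O ⊆ O ∪ extraOpens hkm f t c O := by
  unfold links extraOpens
  split_ifs with h
  · exact (h.choose_spec.2.1.trans (filter_subset _ _)).trans subset_union_left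
  · exact subset_union_right

/-- The factor by which the fractional solution is scaled in the rounding. -/
noncomputable def roundingFactor (n : ℕ) : ℝ := 2 + 2 * Real.log ((n : ℝ) + 1)

theorem two_le_roundingFactor (n : ℕ) : 2 ≤ roundingFactor n := by
  unfold roundingFactor
  linarith [log_card_add_one_nonneg n]

/-- The facilities opened by the rounding, after the clients `σ` have arrived. -/
noncomputable def marked (n k : ℕ) (f : CostVector m) (σ : List (CostVector m))
    (ω : Fin m → unitInterval) : Finset (Fin m) :=
  univ.filter fun j =>
    (ω j : ℝ) < roundingFactor n * openFraction m (f j) (payments k f σ j)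

theorem marked_take_subset (n k : ℕ) (f : CostVector m) (σ : List (CostVector m)) (i : ℕ)
    (ω : Fin m → unitInterval) : marked n k f (σ.take i) ω ⊆ marked n k f σ ω := by
  refine monotone_filter_right _ fun j _ hj => hj.trans_le ?_
  exact mul_le_mul_of_nonneg_left
    (monotone_openFraction m (f j).2 (payments_take_le k f σ i j))
    (by linarith [two_le_roundingFactor n])

theorem measurableSet_marked (n k : ℕ) (f : CostVector m) (σ : List (CostVector m))
    (p : Finset (Fin m) → Prop) : MeasurableSet {ω | p (marked n k f σ ω)} := by
  have h1 : ∀ D, MeasurableSet {ω | marked n k f σ ω = D} := by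
    intro D
    have h2 : {ω | marked n k f σ ω = D} = ⋂ j, {ω : Fin m → unitInterval |
        (ω j : ℝ) < roundingFactor n * openFraction m (f j) (payments k f σ j) ↔ j ∈ D} := by
      ext ω
      simp [marked, Finset.ext_iff]
    rw [h2]
    refine MeasurableSet.iInter fun j => ?_
    by_cases hj : j ∈ D
    · simpa [hj] using measurableSet_setOf_coord_lt j _
    · simp only [hj, iff_false]
      exact (measurableSet_setOf_coord_lt j _).compl
  have h3 : {ω | p (marked n k f σ ω)} =
      ⋃ D : {D // p D}, {ω | marked n k f σ ω = D} := by
    ext ω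
    simp
  rw [h3]
  exact MeasurableSet.iUnion fun D => h1 D

/-- With high probability a client can be served by the facilities that the rounding opens. -/
theorem volume_real_not_isServed_le (n : ℕ) (hk : 1 ≤ k) (hkm : k ≤ m) (f : CostVector m)
    (σ : List (CostVector m)) (c : CostVector m) :
    (volume : Measure (Fin m → unitInterval)).real
      {ω | ¬ IsServed k f (payments k f σ) c (marked n k f (σ ++ [c]) ω)} ≤ 1 / ((n : ℝ) + 1) := by
  have hm : 0 < m := by omega
  have ht := withinBudget_payments k f σ
  have hA := two_le_roundingFactor n
  set A := roundingFactor n with hAdef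
  set t := payments k f σ
  set τ := radius k f t c with hτ
  set x : Fin m → ℝ := fun j => openFraction m (f j) (payment f t c τ j) with hx
  have hx0 : ∀ j, 0 ≤ x j := fun j => openFraction_nonneg m (f j).2 (payment_nonneg ht _ j)
  have hx1 : ∀ j, x j ≤ 1 := fun j => openFraction_le_one hm (f j).2 (payment_le _ j)
  have hmem : ∀ ω j, j ∈ marked n k f (σ ++ [c]) ω ↔ (ω j : ℝ) < A * x j := fun ω j => by
    simp [marked, payments_concat, hx, hAdef, t, τ]
  set N := univ.filter fun j => (c j : ℝ) ≤ τ with hN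
  -- Facilities in `B` are open for every outcome; only those in `R` are random, with probabilities
  -- `A * x j ≤ 1`. It suffices that `k - B.card` of the latter open.
  set B := N.filter fun j => 1 < A * x j with hB
  set R := N.filter fun j => ¬ 1 < A * x j with hR
  have hserved : ∀ ω, k ≤ (N.filter fun j => (ω j : ℝ) < A * x j).card →
      IsServed k f t c (marked n k f (σ ++ [c]) ω) := by
    intro ω hω
    -- Saturated facilities are completely open and `A ≥ 2`, so no threshold excludes them.
    have hZ : saturated k f t c ⊆ N.filter fun j => (ω j : ℝ) < A * x j := by
      intro j hj
      have hj' := (mem_filter.1 hj).2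
      have hxj : x j = 1 := by
        simp only [hx]
        rw [payment_of_saturationRadius_le hj'.le, openFraction_budget hm]
      refine mem_filter.2 ⟨mem_filter.2
        ⟨mem_univ j, ((le_saturationRadius ht j).trans_lt hj').le⟩, ?_⟩
      rw [hxj]
      linarith [(ω j).2.2]
    obtain ⟨T, hZT, hTN, hT⟩ := exists_subsuperset_card_eq hZ (card_saturated_lt hm hk ht).le hω
    refine ⟨T, hZT, fun j hj => ?_, hT⟩
    have hj' := mem_filter.1 (hTN hj)
    exact mem_filter.2 ⟨(hmem ω j).2 hj'.2, (mem_filter.1 hj'.1).2⟩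
  have hsplit : ∀ ω : Fin m → unitInterval, B.card + (R.filter fun j => (ω j : ℝ) < A * x j).card ≤
      (N.filter fun j => (ω j : ℝ) < A * x j).card := by
    intro ω
    rw [← card_union_of_disjoint ((disjoint_filter_filter_not N N _).mono_right (filter_subset _ _))]
    refine card_le_card (union_subset (fun j hj => ?_) (filter_subset_filter _ (filter_subset _ _)))
    exact mem_filter.2 ⟨(mem_filter.1 hj).1, (ω j).2.2.trans_lt (mem_filter.1 hj).2⟩
  have hbad : {ω | ¬ IsServed k f t c (marked n k f (σ ++ [c]) ω)} ⊆
      {ω | (R.filter fun j => (ω j : ℝ) < A * x j).card < k - B.card} := by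
    intro ω hω
    have h1 : (N.filter fun j => (ω j : ℝ) < A * x j).card < k := by
      by_contra! h
      exact hω (hserved ω h)
    have := hsplit ω
    simp only [Set.mem_ofPred_eq]
    omega
  have hn : (0 : ℝ) < (n : ℝ) + 1 := by positivity
  refine (measureReal_mono hbad).trans ?_
  rcases le_or_gt k B.card with hkB | hkB
  · simp only [Nat.sub_eq_zero_of_le hkB, not_lt_zero, Set.ofPred_false, measureReal_empty]
    positivity
  refine (volume_real_card_lt_le R (fun j => A * x j) (fun j hj =>
    ⟨mul_nonneg (by linarith) (hx0 j), not_lt.1 (mem_filter.1 hj).2⟩) _).trans ?_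
  have hsum : (k : ℝ) - B.card ≤ ∑ j ∈ R, x j := by
    have h1 : (k : ℝ) ≤ ∑ j ∈ N, x j := le_sum_openFraction hm hkm ht
    rw [← sum_filter_add_sum_filter_not N (fun j => 1 < A * x j)] at h1
    have h2 : ∑ j ∈ B, x j ≤ B.card := by
      simpa using sum_le_card_nsmul B x 1 fun j _ => hx1 j
    linarith
  have hr : (1 : ℝ) ≤ k - B.card := by
    have : ((B.card : ℝ)) + 1 ≤ k := by exact_mod_cast hkB
    linarith
  -- With `r = k - B.card ≥ 1`, the exponent is at most `r - A r / 2 = -r log (n + 1)`; this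
  -- dictates the choice of `A`.
  rw [one_div, ← Real.exp_log hn, ← Real.exp_neg, Real.exp_le_exp, ← mul_sum, Nat.cast_sub hkB.le]
  have h1 : A * ((k : ℝ) - B.card) ≤ A * ∑ j ∈ R, x j :=
    mul_le_mul_of_nonneg_left hsum (by linarith)
  have h2 : Real.log ((n : ℝ) + 1) = A / 2 - 1 := by rw [hAdef, roundingFactor]; ring
  rw [h2]
  nlinarith

/-- Randomized rounding of the fractional solution, with the cheapest fallback for every client
that the rounding does not serve. -/
noncomputable def roundingAlgorithm (n : ℕ) (hkm : k ≤ m) : RandomizedOnlineAlgorithm m k where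
  Ω := Fin m → unitInterval
  P := volume
  -- The last entry of `h` is the new client; the default `0` only occurs for the empty history,
  -- which `run` never queries.
  opens ω f h := marked n k f h ω ∪
    extraOpens hkm f (payments k f h.dropLast) (h.getLastD 0) (marked n k f h ω)
  connects ω f h := links hkm f (payments k f h.dropLast) (h.getLastD 0) (marked n k f h ω)
  measurable_opens f h D := measurableSet_marked n k f h fun O =>
    O ∪ extraOpens hkm f (payments k f h.dropLast) (h.getLastD 0) O = D
  measurable_connects f h D := measurableSet_marked n k f h fun O =>
    links hkm f (payments k f h.dropLast) (h.getLastD 0) O = D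
  card_connects ω f h _ := (card_links hkm f _ _ _).ge
  connects_open ω f h hne j hj := by
    have hpos : 0 < h.length := List.length_pos_iff.2 hne
    refine ⟨h.length - 1, by omega, ?_⟩
    rw [Nat.sub_add_cancel hpos, List.take_length]
    exact links_subset hkm f _ _ _ hj

theorem integrable_cost_run (A : RandomizedOnlineAlgorithm m k) (f : CostVector m)
    (σ : List (CostVector m)) : Integrable (fun ω => (A.run ω f σ).cost f) A.P := by
  have hset : ∀ (g : A.Ω → Finset (Fin m)), (∀ D, MeasurableSet {ω | g ω = D}) →
      ∀ j, MeasurableSet {ω | j ∈ g ω} := by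
    intro g hg j
    have h : {ω | j ∈ g ω} = ⋃ D : {D : Finset (Fin m) // j ∈ D}, {ω | g ω = D} := by
      ext ω
      simp
    rw [h]
    exact MeasurableSet.iUnion fun D => hg D
  have hsum : ∀ (g : A.Ω → Finset (Fin m)) (w : Fin m → ℝ), (∀ j, MeasurableSet {ω | j ∈ g ω}) →
      Integrable (fun ω => ∑ j ∈ g ω, w j) A.P := by
    intro g w hg
    have h : (fun ω => ∑ j ∈ g ω, w j) =
        fun ω => ∑ j, {ω | j ∈ g ω}.indicator (fun _ => w j) ω := by
      ext ω
      simp [Set.indicator_apply]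
    rw [h]
    exact integrable_finsetSum _ fun j _ => (integrable_const _).indicator (hg j)
  refine (hsum _ _ fun j => ?_).add (integrable_finsetSum _ fun i _ => hsum _ _ fun j => ?_)
  · have h : {ω | j ∈ (A.run ω f σ).opened} =
        ⋃ i ∈ Finset.range σ.length, {ω | j ∈ A.opens ω f (σ.take (i + 1))} := by
      ext ω
      simp [RandomizedOnlineAlgorithm.run]
    rw [h]
    exact Finset.measurableSet_biUnion _ fun i _ => hset _ (A.measurable_opens f _) j
  · exact hset _ (A.measurable_connects f _) j

open Classical in
-- A pointwise bound that only needs expectations of indicators afterwards: a served client connects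
-- at a cost within its value, an unserved one pays at most the optimum for opening and connecting.
theorem cost_run_roundingAlgorithm_le (n : ℕ) (hk : 1 ≤ k) (hkm : k ≤ m) (f : CostVector m)
    (σ : List (CostVector m)) (ω : Fin m → unitInterval) :
    ((roundingAlgorithm n hkm).run ω f σ).cost f ≤
      ∑ j, {ω : Fin m → unitInterval | (ω j : ℝ) <
        roundingFactor n * openFraction m (f j) (payments k f σ j)}.indicator
          (fun _ => (f j : ℝ)) ω + totalValue k f σ +
      ∑ i : Fin σ.length, {ω | ¬ IsServed k f (payments k f (σ.take i)) (σ.get i)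
        (marked n k f (σ.take i ++ [σ.get i]) ω)}.indicator (fun _ => optCost k f σ) ω := by
  have htake : ∀ i : Fin σ.length, σ.take (i + 1) = σ.take i ++ [σ.get i] := fun i => by
    rw [List.get_eq_getElem, List.take_append_getElem]
  set O : Fin σ.length → Finset (Fin m) := fun i =>
    marked n k f (σ.take i ++ [σ.get i]) ω with hO
  set E : Fin σ.length → Finset (Fin m) := fun i =>
    extraOpens hkm f (payments k f (σ.take i)) (σ.get i) (O i) with hE
  set C : Fin σ.length → Finset (Fin m) := fun i =>
    links hkm f (payments k f (σ.take i)) (σ.get i) (O i) with hC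
  have hconn : ∀ i, ((roundingAlgorithm n hkm).run ω f σ).connected i = C i := by
    intro i
    change links hkm f (payments k f (σ.take (i + 1)).dropLast) ((σ.take (i + 1)).getLastD 0)
      (marked n k f (σ.take (i + 1)) ω) = _
    rw [htake]
    simp only [List.dropLast_concat, List.getLastD_concat, hC, hO]
  have hopen : ((roundingAlgorithm n hkm).run ω f σ).opened ⊆
      marked n k f σ ω ∪ univ.biUnion E := by
    intro j hj
    simp only [RandomizedOnlineAlgorithm.run, roundingAlgorithm, mem_biUnion, mem_range] at hj
    obtain ⟨i, hi, hj⟩ := hj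
    rcases mem_union.1 hj with hj | hj
    · exact mem_union_left _ (marked_take_subset n k f σ _ ω hj)
    · refine mem_union_right _ (mem_biUnion.2 ⟨⟨i, hi⟩, mem_univ _, ?_⟩)
      rw [htake ⟨i, hi⟩] at hj
      simpa only [List.dropLast_concat, List.getLastD_concat] using hj
  have hopenCost : ∑ j ∈ ((roundingAlgorithm n hkm).run ω f σ).opened, (f j : ℝ) ≤
      ∑ j ∈ marked n k f σ ω, (f j : ℝ) + ∑ i, ∑ j ∈ E i, (f j : ℝ) := by
    have hnn : ∀ j : Fin m, (0 : ℝ) ≤ f j := fun j => (f j).2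
    refine (sum_le_sum_of_subset_of_nonneg hopen fun j _ _ => hnn j).trans ?_
    have h1 := sum_union_inter (s₁ := marked n k f σ ω) (s₂ := univ.biUnion E)
      (f := fun j => (f j : ℝ))
    have h2 : 0 ≤ ∑ j ∈ marked n k f σ ω ∩ univ.biUnion E, (f j : ℝ) :=
      sum_nonneg fun j _ => hnn j
    have h3 : ∑ j ∈ univ.biUnion E, (f j : ℝ) ≤ ∑ i, ∑ j ∈ E i, (f j : ℝ) := by
      exact sum_biUnion_le_sum_sum hnn univ E
    linarith
  have hclient : ∀ i, ∑ j ∈ E i, (f j : ℝ) + ∑ j ∈ C i, (σ.get i j : ℝ) ≤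
      clientValue k f (payments k f (σ.take i)) (σ.get i) +
      {ω | ¬ IsServed k f (payments k f (σ.take i)) (σ.get i)
        (marked n k f (σ.take i ++ [σ.get i]) ω)}.indicator (fun _ => optCost k f σ) ω := by
    intro i
    by_cases h : IsServed k f (payments k f (σ.take i)) (σ.get i) (O i)
    · rw [Set.indicator_of_notMem (not_not.2 h), add_zero]
      simp only [hE, hC, extraOpens, links, if_pos h, dif_pos h, sum_empty, zero_add]
      obtain ⟨h1, h2, h3⟩ := h.choose_spec
      exact sum_connecting_le_clientValue (withinBudget_payments k f _) h1 h3
        fun j hj => (mem_filter.1 (h2 hj)).2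
    · rw [Set.indicator_of_mem]
      swap
      · exact h
      simp only [hE, hC, extraOpens, links, if_neg h, dif_neg h]
      have h1 := sum_cheapest_le_optCost hkm f σ i
      have h2 := clientValue_nonneg (c := σ.get i) (by omega) hk hkm
        (withinBudget_payments k f (σ.take i))
      linarith
  have hmark : ∑ j, {ω : Fin m → unitInterval | (ω j : ℝ) <
        roundingFactor n * openFraction m (f j) (payments k f σ j)}.indicator
          (fun _ => (f j : ℝ)) ω = ∑ j ∈ marked n k f σ ω, (f j : ℝ) := by
    simp [marked, sum_filter, Set.indicator_apply]
  rw [hmark, Purchase.cost]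
  simp only [hconn]
  have h1 := sum_le_sum fun i (_ : i ∈ univ) => hclient i
  rw [sum_add_distrib, sum_add_distrib] at h1
  have h2 : totalValue k f σ =
    ∑ i : Fin σ.length, clientValue k f (payments k f (σ.take i)) (σ.get i) := rfl
  linarith

theorem optCost_nonneg (hkm : k ≤ m) (f : CostVector m) (σ : List (CostVector m)) :
    0 ≤ optCost k f σ := by
  obtain ⟨S, -, h⟩ := (optCost_isLeast hkm f σ).1
  rw [← h]
  exact add_nonneg (sum_nonneg fun j _ => (f j).2)
    (sum_nonneg fun i _ => sum_nonneg fun j _ => (σ.get i j).2)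

theorem integral_cost_roundingAlgorithm_le (n : ℕ) (hk : 1 ≤ k) (hkm : k ≤ m) (f : CostVector m)
    (σ : List (CostVector m)) :
    ∫ ω, ((roundingAlgorithm n hkm).run ω f σ).cost f ∂(roundingAlgorithm n hkm).P ≤
      (2 * roundingFactor n + 1) * totalValue k f σ +
        σ.length * (1 / ((n : ℝ) + 1) * optCost k f σ) := by
  classical
  have hA := two_le_roundingFactor n
  have hmeas := fun j : Fin m => measurableSet_setOf_coord_lt j
    (roundingFactor n * openFraction m (f j) (payments k f σ j))
  have hmeas' : ∀ i : Fin σ.length, MeasurableSet {ω | ¬ IsServed k f (payments k f (σ.take i))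
      (σ.get i) (marked n k f (σ.take i ++ [σ.get i]) ω)} := fun i =>
    measurableSet_marked n k f _ fun O => ¬ IsServed k f (payments k f (σ.take i)) (σ.get i) O
  have hi1 := integrable_finsetSum (μ := (volume : Measure (Fin m → unitInterval))) univ
    fun j _ => (integrable_const (f j : ℝ)).indicator (hmeas j)
  have hi2 := integrable_finsetSum (μ := (volume : Measure (Fin m → unitInterval))) univ
    fun i _ => (integrable_const (optCost k f σ)).indicator (hmeas' i)
  have hi0 : Integrable (fun ω : Fin m → unitInterval => ((roundingAlgorithm n hkm).run ω f σ).cost f)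
      (volume : Measure (Fin m → unitInterval)) :=
    integrable_cost_run (roundingAlgorithm n hkm) f σ
  have hle := integral_mono hi0 ((hi1.add (integrable_const (totalValue k f σ))).add hi2)
    (cost_run_roundingAlgorithm_le n hk hkm f σ)
  refine le_trans hle ?_
  rw [integral_add' (hi1.add (integrable_const _)) hi2, integral_add' hi1 (integrable_const _),
    integral_finsetSum _ fun j _ => (integrable_const (f j : ℝ)).indicator (hmeas j),
    integral_finsetSum _ fun i _ => (integrable_const (optCost k f σ)).indicator (hmeas' i)]
  simp only [integral_indicator_const _ (hmeas _), integral_indicator_const _ (hmeas' _),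
    smul_eq_mul, integral_const, probReal_univ, one_mul]
  have h1 : ∑ j, (volume : Measure (Fin m → unitInterval)).real {ω | (ω j : ℝ) <
      roundingFactor n * openFraction m (f j) (payments k f σ j)} * (f j : ℝ) ≤
      roundingFactor n * (2 * totalValue k f σ) := by
    refine le_trans ?_ (mul_le_mul_of_nonneg_left (sum_mul_openFraction_le hk hkm σ) (by linarith))
    rw [mul_sum]
    refine sum_le_sum fun j _ => ?_
    refine (mul_le_mul_of_nonneg_right (volume_real_setOf_coord_lt_le j (mul_nonneg (by linarith)
      (openFraction_nonneg m (f j).coe_nonneg (withinBudget_payments k f σ j).1)))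
      (NNReal.coe_nonneg (f j))).trans_eq ?_
    ring
  have h2 : ∑ i : Fin σ.length, (volume : Measure (Fin m → unitInterval)).real
      {ω | ¬ IsServed k f (payments k f (σ.take i)) (σ.get i)
        (marked n k f (σ.take i ++ [σ.get i]) ω)} * optCost k f σ ≤
      σ.length * (1 / ((n : ℝ) + 1) * optCost k f σ) := by
    refine (sum_le_card_nsmul _ _ _ fun (i : Fin σ.length) _ => mul_le_mul_of_nonneg_right
      (volume_real_not_isServed_le n hk hkm f (σ.take i) (σ.get i))
      (optCost_nonneg hkm f σ)).trans_eq ?_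
    simp
  linarith

/-! ### The competitive ratio -/

theorem isCompetitive_roundingAlgorithm (n : ℕ) (hk : 1 ≤ k) (hkm : k ≤ m) :
    (roundingAlgorithm n hkm).IsCompetitive n
      (32 * Real.log ((k : ℝ) * n + 1) * Real.log ((m : ℝ) + 1)) := by
  intro f σ hσ
  refine ⟨integrable_cost_run _ f σ, (integral_cost_roundingAlgorithm_le n hk hkm f σ).trans ?_⟩
  -- For `n = 0` the claimed ratio vanishes, and the bound on the cost is zero as well.
  rcases Nat.eq_zero_or_pos n with rfl | hn
  · obtain rfl : σ = [] := List.length_eq_zero_iff.1 (by omega)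
    simp [totalValue]
  have hk1 : (1 : ℝ) ≤ k := by exact_mod_cast hk
  have hm1 : (1 : ℝ) ≤ m := by exact_mod_cast hk.trans hkm
  have hn1 : (1 : ℝ) ≤ n := by exact_mod_cast hn
  have hlog2 : (1 / 2 : ℝ) ≤ Real.log 2 := by linarith [Real.log_two_gt_d9]
  set L := Real.log ((m : ℝ) + 1) with hL
  set l := Real.log ((k : ℝ) * n + 1) with hl
  have hL2 : 1 / 2 ≤ L := hlog2.trans (Real.log_le_log (by norm_num) (by linarith))
  have hnl : Real.log ((n : ℝ) + 1) ≤ l := Real.log_le_log (by linarith) (by nlinarith)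
  have hl2 : 1 / 2 ≤ l :=
    hlog2.trans ((Real.log_le_log (by norm_num) (by linarith)).trans hnl)
  have hopt := optCost_nonneg hkm f σ
  have hV : totalValue k f σ ≤ 2 * L * optCost k f σ := by
    obtain ⟨S, hS, hcost⟩ := (optCost_isLeast hkm f σ).1
    have h1 := totalValue_le (f := f) hk hkm hS
    rw [Purchase.cost] at hcost
    have h2 : 0 ≤ ∑ j ∈ S.opened, (f j : ℝ) := sum_nonneg fun j _ => (f j).2
    have h3 : 0 ≤ ∑ i, ∑ j ∈ S.connected i, (σ.get i j : ℝ) :=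
      sum_nonneg fun i _ => sum_nonneg fun j _ => (σ.get i j).2
    rw [← hcost]
    nlinarith
  -- The left side is `5 + 4 log (n + 1)`, and `5 ≤ 10 l` as `l ≥ 1/2`.
  have hA : 2 * roundingFactor n + 1 ≤ 14 * l := by
    unfold roundingFactor
    linarith
  have hA0 := two_le_roundingFactor n
  have h1 : (2 * roundingFactor n + 1) * totalValue k f σ ≤
      14 * l * (2 * L * optCost k f σ) :=
    mul_le_mul hA hV (totalValue_nonneg hk hkm σ) (by linarith)
  have h2 : σ.length * (1 / ((n : ℝ) + 1) * optCost k f σ) ≤ 1 * optCost k f σ := by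
    rw [← mul_assoc, mul_one_div]
    have hσ' : (σ.length : ℝ) ≤ n := by exact_mod_cast hσ
    refine mul_le_mul_of_nonneg_right ((div_le_one (by linarith)).2 (by linarith)) hopt
  -- The fallbacks are absorbed using `l, L ≥ 1/2`, and `14 * 2 + 4 = 32`.
  have h3 : 1 * optCost k f σ ≤ 4 * l * L * optCost k f σ :=
    mul_le_mul_of_nonneg_right (by nlinarith) hopt
  linarith

end Algorithm

end MultiFacility

theorem mainTheorem1 :
    ∃ C : ℝ, 0 < C ∧ ∀ m n k : ℕ, 1 ≤ k → k ≤ m →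
      ∃ A : MultiFacility.RandomizedOnlineAlgorithm m k,
        A.IsCompetitive n (C * Real.log ((k : ℝ) * n + 1) * Real.log ((m : ℝ) + 1)) :=
  ⟨32, by norm_num, fun _ n _ hk hkm => ⟨MultiFacility.roundingAlgorithm n hkm,
    MultiFacility.isCompetitive_roundingAlgorithm n hk hkm⟩⟩
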